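/- Let $F=F(x,y)$ be the free group with free basis $\{x,y\}$. Let $\alpha_x$ be the automorphism of $F$ with $x\mapsto x^{-1}$, $y\mapsto y$, let $\alpha_y$ be the automorphism of $F$ with $x\mapsto x$, $y\mapsto y^{-1}$, and let $\Psi\colon F\to F$ be the map $\Psi(w)=\alpha_y(\alpha_x(w^{-1}))$. An element $w\in F$ is called primitive if $w=\theta(x)$ for some automorphism $\theta$ of $F$, and $v\in F$ is called a palindrome if $\Psi(v)=v$ (equivalently, the reduced word of $v$ reads the same forwards and backwards). Lemma (Helling). For each primitive element $p\in F$ there exist a palindrome $v\in F$ and an element $z\in F$ such that either $p=z\,y^{-1}\,v\,x\,z^{-1}$ or $p=z\,x^{-1}\,v\,y\,z^{-1}$. -/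

import Mathlib

namespace RankTwo

/-- The free group `F = F(x, y)` on two generators. -/
abbrev F : Type := FreeGroup (Fin 2)

/-- The first free generator. -/
def x : F := FreeGroup.of 0

/-- The second free generator. -/
def y : F := FreeGroup.of 1

/-- The automorphism of `F` with `x ↦ x⁻¹` and `y ↦ y`. -/
def alphaX : MulAut F :=
  MonoidHom.toMulEquiv (FreeGroup.lift ![x⁻¹, y]) (FreeGroup.lift ![x⁻¹, y])
    (by ext i; fin_cases i <;> simp [x, y])
    (by ext i; fin_cases i <;> simp [x, y])

/-- The automorphism of `F` with `x ↦ x` and `y ↦ y⁻¹`. -/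
def alphaY : MulAut F :=
  MonoidHom.toMulEquiv (FreeGroup.lift ![x, y⁻¹]) (FreeGroup.lift ![x, y⁻¹])
    (by ext i; fin_cases i <;> simp [x, y])
    (by ext i; fin_cases i <;> simp [x, y])

/-- The reversal map `Ψ`: invert `w`, then apply `alphaX` and then `alphaY`. -/
def Psi (w : F) : F := alphaY (alphaX w⁻¹)

/-- `p` is a palindrome if it is fixed by `Ψ`, i.e. it reads the same forwards and backwards. -/
def IsPalindrome (p : F) : Prop := Psi p = p

/-- `w` is primitive if it is the image of `x` under some automorphism of `F`. -/
def IsPrimitive (w : F) : Prop := ∃ θ : MulAut F, θ x = w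

end RankTwo

/-! Write ι for `iota` and κ = conj(xy⁻¹)ι for `kappa`. Every automorphism θ conjugates κ to κ or
κ⁻¹ up to an inner automorphism (`preservesKappa`). Unfolding κ gives θιθ⁻¹ = conj(c)ι with c =
θ(xy⁻¹)⁻¹·w·u·Ψ(w) and u = xy⁻¹ or y⁻¹x. As ι² = 1 and F has trivial centre, c is a palindrome.
Solving for θ(x) gives θ(x) = w·u·v·w⁻¹ with v a palindrome, the claim up to conjugation and
reversal.

`preservesKappa` is checked on Nielsen generators. That these suffice is Nielsen's method: in a
counterexample minimising |θ(x)| + |θ(y)|, cancellation between images of letters is so limited that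
θ shortens no word (`length_le_norm`). Hence θ⁻¹ sends x and y to letters, so θ is a signed
permutation, for which the claim is known. -/

namespace FreeGroup

/-! ### Common prefixes and cancellation in free groups -/

variable {α : Type*} [DecidableEq α]

/-- The length of the longest common prefix of two lists. -/
def commonPrefixLength {β : Type*} [DecidableEq β] : List β → List β → ℕ
  | a :: l, b :: m => if a = b then commonPrefixLength l m + 1 else 0
  | [], _ => 0
  | _ :: _, [] => 0

theorem commonPrefixLength_comm {β : Type*} [DecidableEq β] (l m : List β) :
    commonPrefixLength l m = commonPrefixLength m l := by
  induction l generalizing m with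
  | nil => cases m <;> simp [commonPrefixLength]
  | cons a l ih =>
    cases m with
    | nil => simp [commonPrefixLength]
    | cons b m => simp [commonPrefixLength, ih m, eq_comm]

/-- The ultrametric inequality: with length identities, it reduces all later prefix comparisons to
linear arithmetic. -/
theorem min_commonPrefixLength_le {β : Type*} [DecidableEq β] (l m k : List β) :
    min (commonPrefixLength l m) (commonPrefixLength m k) ≤ commonPrefixLength l k := by
  induction l generalizing m k with
  | nil => cases m <;> simp [commonPrefixLength]
  | cons a l ih =>
    cases m with
    | nil => simp [commonPrefixLength]
    | cons b m =>
      cases k with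
      | nil => simp [commonPrefixLength]
      | cons d k =>
        have := ih m k
        simp only [commonPrefixLength]
        split_ifs <;> simp_all

theorem IsReduced.invRev {L : List (α × Bool)} (h : IsReduced L) : IsReduced (invRev L) := by
  rw [isReduced_iff_reduce_eq] at h ⊢
  rw [reduce_invRev, h]

theorem norm_mk_of_isReduced {L : List (α × Bool)} (h : IsReduced L) :
    norm (mk L) = L.length := by
  rw [norm, toWord_mk, h.reduce_eq]

theorem norm_inv_mk_mul_mk (L M : List (α × Bool)) (hL : IsReduced L) (hM : IsReduced M) :
    norm ((mk L)⁻¹ * mk M) + 2 * commonPrefixLength L M = L.length + M.length := by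
  induction L generalizing M with
  | nil =>
    have : (mk ([] : List (α × Bool)))⁻¹ = 1 := by rw [← one_eq_mk, inv_one]
    simp [commonPrefixLength, this, norm_mk_of_isReduced hM]
  | cons a L ih =>
    cases M with
    | nil =>
      have : (mk ([] : List (α × Bool))) = 1 := by rw [← one_eq_mk]
      simp [commonPrefixLength, this, norm_mk_of_isReduced hL, -inv_mk]
    | cons b M =>
      by_cases hab : a = b
      · subst hab
        have h := ih M (hL.infix ⟨[a], [], by simp⟩) (hM.infix ⟨[a], [], by simp⟩)
        have e : (mk (a :: L))⁻¹ * mk (a :: M) = (mk L)⁻¹ * mk M := by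
          rw [show a :: L = [a] ++ L from rfl, show a :: M = [a] ++ M from rfl, ← mul_mk, ← mul_mk]
          group
        rw [e]
        simp only [commonPrefixLength, if_true, List.length_cons]
        omega
      · have hr : IsReduced (FreeGroup.invRev (a :: L) ++ b :: M) := by
          rw [invRev_cons, show b :: M = [b] ++ M from rfl, List.append_assoc,
            ← List.append_assoc (FreeGroup.invRev [a]), ← List.append_assoc]
          rw [show FreeGroup.invRev [a] = [(a.1, !a.2)] by simp [FreeGroup.invRev]]
          have h1 : IsReduced (FreeGroup.invRev L ++ [(a.1, !a.2)]) := by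
            have := hL.invRev
            rwa [invRev_cons, show FreeGroup.invRev [a] = [(a.1, !a.2)] by
              simp [FreeGroup.invRev]] at this
          have h2 : IsReduced ([(a.1, !a.2)] ++ (b :: M)) := by
            rw [List.singleton_append, isReduced_cons_cons]
            refine ⟨fun h => ?_, hM⟩
            by_contra h'
            apply hab
            ext1
            · exact h
            · simpa using h'
          have := h1.append_overlap h2 (by simp)
          simpa using this
        rw [inv_mk, mul_mk, norm_mk_of_isReduced hr]
        simp [commonPrefixLength, hab]

/-- The Gromov product of two elements of a free group: the length of the longest common prefix of
their reduced words. -/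
def gromovProduct (u v : FreeGroup α) : ℕ := commonPrefixLength u.toWord v.toWord

theorem norm_inv_mul_add (u v : FreeGroup α) :
    norm (u⁻¹ * v) + 2 * gromovProduct u v = norm u + norm v := by
  have := norm_inv_mk_mul_mk u.toWord v.toWord isReduced_toWord isReduced_toWord
  rwa [mk_toWord, mk_toWord] at this

theorem gromovProduct_comm (u v : FreeGroup α) : gromovProduct u v = gromovProduct v u :=
  commonPrefixLength_comm _ _

theorem min_gromovProduct_le (u v w : FreeGroup α) :
    min (gromovProduct u v) (gromovProduct v w) ≤ gromovProduct u w :=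
  min_commonPrefixLength_le _ _ _

theorem norm_mul_add (u v : FreeGroup α) :
    norm (u * v) + 2 * gromovProduct u⁻¹ v = norm u + norm v := by
  simpa using norm_inv_mul_add u⁻¹ v

/-- An element can be cut at any position of its reduced word. -/
theorem exists_mul_eq_of_le_norm (v : FreeGroup α) {k : ℕ} (hk : k ≤ norm v) :
    ∃ a b : FreeGroup α, v = a * b ∧ norm a = k ∧ norm a + norm b = norm v := by
  have h := isReduced_toWord (x := v)
  have h1 := norm_mk_of_isReduced (h.infix (List.take_prefix k _).isInfix)
  have h2 := norm_mk_of_isReduced (h.infix (List.drop_suffix k _).isInfix)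
  rw [List.length_take, ← norm] at h1
  rw [List.length_drop, ← norm] at h2
  exact ⟨mk (v.toWord.take k), mk (v.toWord.drop k),
    by rw [mul_mk, List.take_append_drop, mk_toWord], by omega, by omega⟩

theorem norm_lt_norm_mul_self {v : FreeGroup α} (hv : v ≠ 1) : norm v < norm (v * v) := by
  have h1 : norm v = 2 * (reduceCyclically.conjugator v.toWord).length +
      (reduceCyclically v.toWord).length := by
    rw [norm]
    conv_lhs => rw [← reduceCyclically.conj_conjugator_reduceCyclically v.toWord]
    simp
    omega
  have h2 : norm (v * v) = 2 * (reduceCyclically.conjugator v.toWord).length +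
      2 * (reduceCyclically v.toWord).length := by
    rw [← pow_two, norm, toWord_pow, reduceCyclically.reduce_flatten_replicate_succ isReduced_toWord]
    simp
    omega
  have h3 : (reduceCyclically v.toWord).length ≠ 0 := fun h => hv <| by
    rw [List.length_eq_zero_iff] at h
    have h4 := reduceCyclically.conj_conjugator_reduceCyclically v.toWord
    rw [h, List.append_nil] at h4
    rw [← mk_toWord (x := v), ← h4, ← mul_mk, ← inv_mk, mul_inv_cancel]
  omega

end FreeGroup

namespace RankTwo

/-! ### Automorphisms respecting the class of κ -/

open FreeGroup

@[simp] theorem alphaX_x : alphaX x = x⁻¹ := by simp [alphaX, x]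
@[simp] theorem alphaX_y : alphaX y = y := by simp [alphaX, y]
@[simp] theorem alphaY_x : alphaY x = x := by simp [alphaY, x]
@[simp] theorem alphaY_y : alphaY y = y⁻¹ := by simp [alphaY, y]

theorem mulAut_ext {θ φ : MulAut F} (hx : θ x = φ x) (hy : θ y = φ y) : θ = φ := by
  have h : θ.toMonoidHom = φ.toMonoidHom := by
    ext i
    fin_cases i
    · exact hx
    · exact hy
  ext w
  exact DFunLike.congr_fun h w

/-- The automorphism of `F` exchanging `x` and `y`. -/
def swap : MulAut F :=
  MonoidHom.toMulEquiv (FreeGroup.lift ![y, x]) (FreeGroup.lift ![y, x])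
    (by ext i; fin_cases i <;> simp [x, y])
    (by ext i; fin_cases i <;> simp [x, y])

/-- The automorphism of `F` with `x ↦ x * y` and `y ↦ y`. -/
def transvection : MulAut F :=
  MonoidHom.toMulEquiv (FreeGroup.lift ![x * y, y]) (FreeGroup.lift ![x * y⁻¹, y])
    (by ext i; fin_cases i <;> simp [x, y])
    (by ext i; fin_cases i <;> simp [x, y])

@[simp] theorem swap_x : swap x = y := by simp [swap, x]
@[simp] theorem swap_y : swap y = x := by simp [swap, y]
@[simp] theorem transvection_x : transvection x = x * y := by simp [transvection, x]
@[simp] theorem transvection_y : transvection y = y := by simp [transvection, y]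

/-- The automorphism of `F` inverting both generators. -/
def iota : MulAut F := alphaY * alphaX

@[simp] theorem iota_x : iota x = x⁻¹ := by simp [iota]
@[simp] theorem iota_y : iota y = y⁻¹ := by simp [iota]

theorem iota_mul_iota : iota * iota = 1 := mulAut_ext (by simp) (by simp)

@[simp] theorem iota_iota (w : F) : iota (iota w) = w :=
  DFunLike.congr_fun iota_mul_iota w

theorem Psi_eq (w : F) : Psi w = (iota w)⁻¹ := by simp [Psi, iota]

theorem mul_conj_mul_inv (θ : MulAut F) (w : F) :
    θ * MulAut.conj w * θ⁻¹ = MulAut.conj (θ w) := by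
  ext v
  simp

theorem mul_conj (θ : MulAut F) (w : F) :
    θ * MulAut.conj w = MulAut.conj (θ w) * θ := by
  rw [← mul_conj_mul_inv, inv_mul_cancel_right]

/-- A square root of the inner automorphism by `[x, y]`, up to conjugation. -/
def kappa : MulAut F := MulAut.conj (x * y⁻¹) * iota

theorem kappa_inv : kappa⁻¹ = MulAut.conj (y⁻¹ * x) * iota := by
  rw [inv_eq_iff_mul_eq_one]
  exact mulAut_ext (by simp [kappa, mul_assoc]) (by simp [kappa, mul_assoc])

/-- Moving conj(w)⁻¹ leftwards past ι turns it into conj(Ψ(w)). -/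
theorem conj_mul_conj_mul_iota_mul_inv (w u : F) :
    MulAut.conj w * (MulAut.conj u * iota) * (MulAut.conj w)⁻¹ =
      MulAut.conj (w * u * Psi w) * iota := by
  rw [← _root_.map_inv, mul_assoc, mul_assoc, mul_conj, Psi_eq, _root_.map_mul, _root_.map_mul, _root_.map_inv iota]
  simp only [mul_assoc]

/-- The automorphisms that send the conjugacy class of `kappa` to itself or to that of
`kappa⁻¹`. -/
def PreservesKappa (θ : MulAut F) : Prop :=
  ∃ w, θ * kappa * θ⁻¹ = MulAut.conj w * kappa * (MulAut.conj w)⁻¹ ∨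
    θ * kappa * θ⁻¹ = MulAut.conj w * kappa⁻¹ * (MulAut.conj w)⁻¹

namespace PreservesKappa

theorem one : PreservesKappa 1 := ⟨1, Or.inl (by simp)⟩

theorem conj (w : F) : PreservesKappa (MulAut.conj w) := ⟨w, Or.inl rfl⟩

theorem mul {θ φ : MulAut F} (hθ : PreservesKappa θ) (hφ : PreservesKappa φ) :
    PreservesKappa (θ * φ) := by
  obtain ⟨w, hw⟩ := hθ
  obtain ⟨v, hv⟩ := hφ
  have key (g : MulAut F) : θ * (MulAut.conj v * g * (MulAut.conj v)⁻¹) * θ⁻¹ =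
      MulAut.conj (θ v) * (θ * g * θ⁻¹) * (MulAut.conj (θ v))⁻¹ := by
    rw [← mul_conj_mul_inv]
    group
  have key' : θ * φ * kappa * (θ * φ)⁻¹ = θ * (φ * kappa * φ⁻¹) * θ⁻¹ := by group
  have inv : θ * kappa⁻¹ * θ⁻¹ = (θ * kappa * θ⁻¹)⁻¹ := by group
  refine ⟨θ v * w, ?_⟩
  rw [key', _root_.map_mul]
  rcases hv with hv | hv <;> rw [hv, key]
  · rcases hw with hw | hw <;> rw [hw]
    · left; group
    · right; group
  · rw [inv]
    rcases hw with hw | hw <;> rw [hw]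
    · right; group
    · left; group

theorem inv {θ : MulAut F} (hθ : PreservesKappa θ) : PreservesKappa θ⁻¹ := by
  obtain ⟨w, hw⟩ := hθ
  refine ⟨θ⁻¹ w⁻¹, ?_⟩
  rw [← mul_conj_mul_inv, _root_.map_inv]
  rcases hw with hw | hw
  · left
    have : kappa = (MulAut.conj w)⁻¹ * (θ * kappa * θ⁻¹) * MulAut.conj w := by rw [hw]; group
    conv_lhs => rw [this]
    group
  · right
    have : kappa = (MulAut.conj w)⁻¹ * (θ * kappa⁻¹ * θ⁻¹) * MulAut.conj w := by
      rw [show θ * kappa⁻¹ * θ⁻¹ = (θ * kappa * θ⁻¹)⁻¹ by group, hw]; group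
    conv_lhs => rw [this]
    group

theorem alphaX : PreservesKappa alphaX := by
  refine ⟨x⁻¹, Or.inr ?_⟩
  rw [mul_inv_eq_iff_eq_mul, kappa_inv, conj_mul_conj_mul_iota_mul_inv, Psi_eq]
  exact mulAut_ext (by simp [kappa, mul_assoc]) (by simp [kappa, mul_assoc])

theorem swap : PreservesKappa swap := by
  refine ⟨y * x⁻¹, Or.inr ?_⟩
  rw [mul_inv_eq_iff_eq_mul, kappa_inv, conj_mul_conj_mul_iota_mul_inv, Psi_eq]
  exact mulAut_ext (by simp [kappa, mul_assoc]) (by simp [kappa, mul_assoc])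

theorem transvection : PreservesKappa transvection := by
  refine ⟨1, Or.inl ?_⟩
  rw [mul_inv_eq_iff_eq_mul]
  exact mulAut_ext (by simp [kappa, mul_assoc]) (by simp [kappa, mul_assoc])

end PreservesKappa

/-- The complexity of an automorphism: the total length of the images of the generators. -/
def complexity (θ : MulAut F) : ℕ := norm (θ x) + norm (θ y)

/-- The element of `F` spelled by a single letter. -/
def letter (s : Fin 2 × Bool) : F := mk [s]

theorem exists_signed_permutation (s t : Fin 2 × Bool) (h : s.1 ≠ t.1) :
    ∃ π : MulAut F, PreservesKappa π ∧ π x = letter s ∧ π y = letter t ∧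
      ∀ θ, complexity (θ * π) = complexity θ := by
  have hX := PreservesKappa.alphaX
  have hS := PreservesKappa.swap
  have hY : PreservesKappa alphaY := by
    have : alphaY = swap * alphaX * swap := mulAut_ext (by simp) (by simp)
    rw [this]
    exact (hS.mul hX).mul hS
  have e1 : letter (0, true) = x := rfl
  have e2 : letter (1, true) = y := rfl
  have e3 : letter (0, false) = x⁻¹ := rfl
  have e4 : letter (1, false) = y⁻¹ := rfl
  obtain ⟨i, b⟩ := s
  obtain ⟨j, d⟩ := t
  have c1 (θ : MulAut F) : norm (θ y) + norm (θ x) = norm (θ x) + norm (θ y) := add_comm _ _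
  fin_cases i <;> fin_cases j <;> simp at h <;> cases b <;> cases d <;>
    simp only [Fin.mk_zero, Fin.mk_one, e1, e2, e3, e4]
  · exact ⟨alphaX * alphaY, hX.mul hY, by simp, by simp, fun θ => by simp [complexity]⟩
  · exact ⟨alphaX, hX, by simp, by simp, fun θ => by simp [complexity]⟩
  · exact ⟨alphaY, hY, by simp, by simp, fun θ => by simp [complexity]⟩
  · exact ⟨1, .one, by simp, by simp, fun θ => by simp [complexity]⟩
  · exact ⟨alphaX * alphaY * swap, (hX.mul hY).mul hS, by simp, by simp,
      fun θ => by simp [complexity, c1]⟩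
  · exact ⟨alphaY * swap, hY.mul hS, by simp, by simp, fun θ => by simp [complexity, c1]⟩
  · exact ⟨alphaX * swap, hX.mul hS, by simp, by simp, fun θ => by simp [complexity, c1]⟩
  · exact ⟨swap, hS, by simp, by simp, fun θ => by simp [complexity, c1]⟩

theorem eq_one_of_commute (z : F) (hx : Commute z x) (hy : Commute z y) : z = 1 := by
  rw [← toWord_eq_nil_iff]
  by_contra hne
  obtain ⟨s, L, hL⟩ := List.exists_cons_of_ne_nil hne
  have hr : IsReduced (s :: L) := hL ▸ isReduced_toWord
  obtain ⟨i, hi⟩ : ∃ i : Fin 2, i ≠ s.1 := exists_ne _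
  have hc : z * of i = of i * z := by
    fin_cases i
    · exact hx
    · exact hy
  have h1 : (of i * z).toWord = (i, true) :: s :: L := by
    rw [toWord_mul, hL, toWord_of, List.singleton_append, IsReduced.reduce_eq]
    exact isReduced_cons_cons.2 ⟨fun h => absurd h hi, hr⟩
  -- The word of z·of i is a sublist of z's word followed by i; equal lengths force equality, but
  -- the first letters differ.
  have h2 := toWord_mul_sublist z (of i)
  rw [hc, h1, hL, toWord_of] at h2
  have h3 := h2.eq_of_length (by simp)
  simp only [List.cons_append, List.cons.injEq] at h3
  exact hi (congrArg Prod.fst h3.1)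

end RankTwo

/-! ### Cancellation of exactly half a word -/

namespace FreeGroup

variable {α : Type*} [DecidableEq α]

/-- If exactly half of `q` cancels in both `p * q` and `q * p⁻¹`, then `q = 1`. -/
theorem eq_one_of_two_mul_gromovProduct_eq {p q : FreeGroup α}
    (h1 : 2 * gromovProduct p⁻¹ q = norm q) (h2 : 2 * gromovProduct q⁻¹ p⁻¹ = norm q) :
    q = 1 := by
  -- Both a and b⁻¹ are prefixes of p⁻¹ of the same length, so a = b⁻¹.
  obtain ⟨a, b, rfl, ha, hab⟩ := exists_mul_eq_of_le_norm q (k := norm q / 2) (by omega)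
  have h3 := norm_inv_mul_add (a * b) a
  have h4 := norm_inv_mul_add b⁻¹ (a * b)⁻¹
  have e3 : norm ((a * b)⁻¹ * a) = norm b := by simp
  have e4 : norm (b⁻¹⁻¹ * (a * b)⁻¹) = norm a := by simp
  rw [norm_inv_eq, norm_inv_eq] at h4
  have h5 := min_gromovProduct_le p⁻¹ (a * b) a
  have h6 := min_gromovProduct_le b⁻¹ (a * b)⁻¹ p⁻¹
  have h7 := min_gromovProduct_le b⁻¹ p⁻¹ a
  have h8 := norm_mul_add b a
  have h9 : b * a = 1 := norm_eq_zero.1 (by omega)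
  rw [eq_inv_of_mul_eq_one_left h9]
  simp

/-- If exactly half of `q` cancels in both `p * q` and `q * p`, then conjugation shortens `p * q`. -/
theorem exists_norm_conj_lt {p q : FreeGroup α} (hq : q ≠ 1)
    (h1 : 2 * gromovProduct p⁻¹ q = norm q) (h2 : 2 * gromovProduct q⁻¹ p = norm q)
    (hpq : norm q ≤ norm p) :
    ∃ b : FreeGroup α, norm (b * (p * q) * b⁻¹) + norm (b * q * b⁻¹) < norm p + norm q := by
  obtain ⟨a, b, rfl, ha, hab⟩ := exists_mul_eq_of_le_norm q (k := norm q / 2) (by omega)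
  have hq' : norm (a * b) ≠ 0 := by simpa using hq
  -- Here p = b⁻¹·m·a⁻¹ without overlap as |q| ≤ |p|, so b(pq)b⁻¹ = m has length |p| − |q|, while
  -- bqb⁻¹ = ba is no longer than q.
  refine ⟨b, ?_⟩
  have e1 : b * (p * (a * b)) * b⁻¹ = b * (p * a) := by group
  have e2 : b * (a * b) * b⁻¹ = b * a := by group
  rw [e1, e2]
  have h3 := norm_inv_mul_add (a * b) a
  have h4 := norm_inv_mul_add b⁻¹ (a * b)⁻¹
  have e3 : norm ((a * b)⁻¹ * a) = norm b := by simp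
  have e4 : norm (b⁻¹⁻¹ * (a * b)⁻¹) = norm a := by simp
  rw [norm_inv_eq, norm_inv_eq] at h4
  have h5 := min_gromovProduct_le p⁻¹ (a * b) a
  have h6 := min_gromovProduct_le b⁻¹ (a * b)⁻¹ p
  have h7 := norm_mul_add p a
  have h8 := norm_inv_mul_add p (p * a)
  have e8 : p⁻¹ * (p * a) = a := by group
  rw [e8] at h8
  have h9 := min_gromovProduct_le b⁻¹ p (p * a)
  have h10 := norm_mul_add b (p * a)
  have h11 := norm_mul_le b a
  omega

end FreeGroup

/-! ### Nielsen reduction of a minimal counterexample -/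

namespace RankTwo

open FreeGroup

/-- A counterexample to `PreservesKappa` of minimal complexity. -/
structure IsMinimalCounterexample (θ : MulAut F) : Prop where
  intro ::
  not_preservesKappa : ¬ PreservesKappa θ
  preservesKappa_of_lt : ∀ φ, complexity φ < complexity θ → PreservesKappa φ

namespace IsMinimalCounterexample

variable {θ : MulAut F}

theorem mul (h : IsMinimalCounterexample θ) {π : MulAut F} (hπ : PreservesKappa π)
    (hc : ∀ θ, complexity (θ * π) = complexity θ) : IsMinimalCounterexample (θ * π) where
  not_preservesKappa h' := h.not_preservesKappa (by simpa using h'.mul hπ.inv)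
  preservesKappa_of_lt φ hφ := h.preservesKappa_of_lt φ (hc θ ▸ hφ)

theorem complexity_le (h : IsMinimalCounterexample θ) (w : F) :
    complexity θ ≤ complexity (MulAut.conj w * θ * transvection) := by
  by_contra hlt
  have h1 := h.preservesKappa_of_lt _ (not_le.1 hlt)
  apply h.not_preservesKappa
  have h2 := ((PreservesKappa.conj w⁻¹).mul h1).mul PreservesKappa.transvection.inv
  rw [_root_.map_inv] at h2
  convert h2 using 1
  group

theorem exists_signed_permutation (h : IsMinimalCounterexample θ) {s t : Fin 2 × Bool}
    (hst : s.1 ≠ t.1) : ∃ φ, IsMinimalCounterexample φ ∧ φ x = θ (letter s) ∧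
      φ y = θ (letter t) := by
  obtain ⟨π, hπ, hx, hy, hc⟩ := RankTwo.exists_signed_permutation s t hst
  exact ⟨θ * π, h.mul hπ hc, by simp [hx], by simp [hy]⟩

theorem norm_le_norm_mul (h : IsMinimalCounterexample θ) {s t : Fin 2 × Bool}
    (hst : s.1 ≠ t.1) : norm (θ (letter s)) ≤ norm (θ (letter s) * θ (letter t)) := by
  obtain ⟨φ, hφ, hx, hy⟩ := h.exists_signed_permutation hst
  have := hφ.complexity_le 1
  rw [← hx, ← hy]
  simpa [complexity] using this

theorem norm_le_norm_conj (h : IsMinimalCounterexample θ) {s t : Fin 2 × Bool}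
    (hst : s.1 ≠ t.1) (w : F) : norm (θ (letter s)) + norm (θ (letter t)) ≤
      norm (w * (θ (letter s) * θ (letter t)) * w⁻¹) + norm (w * θ (letter t) * w⁻¹) := by
  obtain ⟨φ, hφ, hx, hy⟩ := h.exists_signed_permutation hst
  have := hφ.complexity_le w
  rw [← hx, ← hy]
  simpa [complexity] using this

end IsMinimalCounterexample

theorem letter_inv (s : Fin 2 × Bool) : (letter s)⁻¹ = letter (s.1, !s.2) := by
  simp [letter, invRev]

theorem letter_ne_one (s : Fin 2 × Bool) : letter s ≠ 1 := by
  refine FreeGroup.norm_eq_zero.not.1 ?_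
  rw [letter, norm_mk_of_isReduced .singleton]
  simp

theorem apply_letter_ne_one (θ : MulAut F) (s : Fin 2 × Bool) : θ (letter s) ≠ 1 := by
  simpa using letter_ne_one s

namespace IsMinimalCounterexample

variable {θ : MulAut F}

theorem two_mul_gromovProduct_le (h : IsMinimalCounterexample θ) {s t : Fin 2 × Bool}
    (hst : s.1 = t.1 → s.2 = t.2) :
    2 * gromovProduct (θ (letter s))⁻¹ (θ (letter t)) ≤ norm (θ (letter s)) ∧
    2 * gromovProduct (θ (letter s))⁻¹ (θ (letter t)) ≤ norm (θ (letter t)) ∧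
    (s.1 = t.1 → 2 * gromovProduct (θ (letter s))⁻¹ (θ (letter t)) < norm (θ (letter t))) := by
  have h1 := norm_mul_add (θ (letter s)) (θ (letter t))
  by_cases heq : s.1 = t.1
  · obtain rfl : s = t := Prod.ext heq (hst heq)
    have := norm_lt_norm_mul_self (apply_letter_ne_one θ s)
    omega
  · have h2 := h.norm_le_norm_mul heq
    have h3 := h.norm_le_norm_mul (s := (t.1, !t.2)) (t := (s.1, !s.2)) (Ne.symm heq)
    rw [← letter_inv, ← letter_inv, _root_.map_inv, _root_.map_inv, ← mul_inv_rev, norm_inv_eq,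
      norm_inv_eq] at h3
    refine ⟨by omega, by omega, fun h => absurd h heq⟩

/-- Otherwise each neighbour cancels exactly half of θ(t), so s and r involve the other generator.
If r = s, a conjugation followed by a transvection lowers the complexity; if r = s⁻¹, then θ(t) = 1.
-/
theorem gromovProduct_add_lt (h : IsMinimalCounterexample θ) {s t r : Fin 2 × Bool}
    (hst : s.1 = t.1 → s.2 = t.2) (htr : t.1 = r.1 → t.2 = r.2) :
    gromovProduct (θ (letter s))⁻¹ (θ (letter t)) +
      gromovProduct (θ (letter t))⁻¹ (θ (letter r)) < norm (θ (letter t)) := by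
  by_contra hlt
  obtain ⟨h1, h2, h3⟩ := h.two_mul_gromovProduct_le hst
  obtain ⟨h4, h5, h6⟩ := h.two_mul_gromovProduct_le htr
  have hs : s.1 ≠ t.1 := fun e => by have := h3 e; omega
  have hr : t.1 ≠ r.1 := fun e => by
    obtain rfl : t = r := Prod.ext e (htr e)
    have := h6 rfl
    omega
  have hsr : s.1 = r.1 := by omega
  by_cases hb : s.2 = r.2
  · obtain rfl : s = r := Prod.ext hsr hb
    obtain ⟨b, hb⟩ := exists_norm_conj_lt (apply_letter_ne_one θ t) (p := θ (letter s))
      (by omega) (by omega) (by omega)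
    have := h.norm_le_norm_conj hs b
    omega
  · obtain rfl : r = (s.1, !s.2) := by
      refine Prod.ext hsr.symm ?_
      cases hs2 : s.2 <;> cases hr2 : r.2 <;> simp_all
    rw [← letter_inv, _root_.map_inv] at hlt h4 h5
    exact apply_letter_ne_one θ t
      (eq_one_of_two_mul_gromovProduct_eq (p := θ (letter s)) (by omega) (by omega))

end IsMinimalCounterexample

/-- The cancellation between the image of a letter and that of the first letter of a list. -/
def headCancellation (θ : MulAut F) (t : Fin 2 × Bool) : List (Fin 2 × Bool) → ℕ
  | [] => 0
  | r :: _ => gromovProduct (θ (letter t))⁻¹ (θ (letter r))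

theorem mk_cons (t : Fin 2 × Bool) (L : List (Fin 2 × Bool)) : mk (t :: L) = letter t * mk L := by
  rw [letter, mul_mk, List.singleton_append]

namespace IsMinimalCounterexample

variable {θ : MulAut F}

theorem gromovProduct_add_headCancellation_lt (h : IsMinimalCounterexample θ)
    {s t : Fin 2 × Bool} {L : List (Fin 2 × Bool)} (hst : s.1 = t.1 → s.2 = t.2)
    (hL : IsReduced (t :: L)) :
    gromovProduct (θ (letter s))⁻¹ (θ (letter t)) + headCancellation θ t L <
      norm (θ (letter t)) := by
  cases L with
  | nil =>
    have := (h.two_mul_gromovProduct_le hst).2.1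
    have h0 : norm (θ (letter t)) ≠ 0 := FreeGroup.norm_eq_zero.not.2 (apply_letter_ne_one θ t)
    simp only [headCancellation]
    omega
  | cons r L => exact h.gromovProduct_add_lt hst (isReduced_cons_cons.1 hL).1

/-- Some of each letter's image survives cancellation on both sides, so prepending a letter adds at
least one to the surviving length. -/
theorem gromovProduct_mk_cons (h : IsMinimalCounterexample θ)
    (L : List (Fin 2 × Bool)) (t : Fin 2 × Bool) (hL : IsReduced (t :: L)) :
    gromovProduct (θ (mk (t :: L))) (θ (letter t)) + headCancellation θ t L =
        norm (θ (letter t)) ∧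
      norm (θ (letter t)) + L.length ≤ norm (θ (mk (t :: L))) + headCancellation θ t L := by
  induction L generalizing t with
  | nil =>
    have := norm_inv_mul_add (θ (letter t)) (θ (letter t))
    rw [inv_mul_cancel, FreeGroup.norm_one] at this
    have e : mk [t] = letter t := rfl
    simp only [headCancellation, e, List.length_nil]
    omega
  | cons r L ih =>
    obtain ⟨htr, hL'⟩ := isReduced_cons_cons.1 hL
    obtain ⟨ih1, ih2⟩ := ih r hL'
    have h1 := h.gromovProduct_add_headCancellation_lt htr hL'
    rw [mk_cons t, _root_.map_mul]
    simp only [headCancellation, List.length_cons]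
    generalize θ (mk (r :: L)) = v at *
    have h2 := min_gromovProduct_le (θ (letter t))⁻¹ (θ (letter r)) v
    have h3 := min_gromovProduct_le (θ (letter t))⁻¹ v (θ (letter r))
    rw [gromovProduct_comm (θ (letter r)) v] at h2
    have h4 := norm_mul_add (θ (letter t)) v
    have h5 := norm_inv_mul_add (θ (letter t) * v) (θ (letter t))
    have e5 : norm ((θ (letter t) * v)⁻¹ * θ (letter t)) = norm v := by simp
    omega

theorem length_le_norm (h : IsMinimalCounterexample θ) (w : F) : norm w ≤ norm (θ w) := by
  cases hw : w.toWord with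
  | nil => simp [FreeGroup.norm, hw]
  | cons t L =>
    have hL : IsReduced (t :: L) := hw ▸ isReduced_toWord
    have h1 := (h.gromovProduct_mk_cons L t hL).2
    have h2 := h.gromovProduct_add_headCancellation_lt (s := t) (fun _ => rfl) hL
    rw [← hw, mk_toWord] at h1
    have h3 : norm w = L.length + 1 := by rw [FreeGroup.norm, hw, List.length_cons]
    omega

theorem exists_letter_eq (h : IsMinimalCounterexample θ) {v : F} (hv : norm v = 1) :
    ∃ s, θ⁻¹ v = letter s := by
  have h1 := h.length_le_norm (θ⁻¹ v)
  rw [MulAut.apply_inv_self, hv] at h1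
  have h2 : norm (θ⁻¹ v) ≠ 0 := fun h0 => by
    rw [FreeGroup.norm_eq_zero] at h0
    have : v = 1 := by simpa using h0
    simp [this] at hv
  obtain ⟨s, hs⟩ := List.length_eq_one_iff.1 (show (θ⁻¹ v).toWord.length = 1 by
    rw [FreeGroup.norm] at h1 h2; omega)
  exact ⟨s, by rw [letter, ← hs, mk_toWord]⟩

end IsMinimalCounterexample

theorem not_isMinimalCounterexample (θ : MulAut F) : ¬ IsMinimalCounterexample θ := by
  intro h
  obtain ⟨s, hs⟩ := h.exists_letter_eq (v := x) rfl
  obtain ⟨t, ht⟩ := h.exists_letter_eq (v := y) rfl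
  have hst : s.1 ≠ t.1 := fun e => by
    by_cases hb : s.2 = t.2
    · rw [Prod.ext e hb, ← ht] at hs
      exact absurd (θ⁻¹.injective hs) (by decide)
    · have e' : t = (s.1, !s.2) := by
        refine Prod.ext e.symm ?_
        cases hs2 : s.2 <;> cases ht2 : t.2 <;> simp_all
      rw [e', ← letter_inv, ← hs, ← _root_.map_inv] at ht
      exact absurd (θ⁻¹.injective ht) (by decide)
  obtain ⟨π, hπ, hx, hy, -⟩ := exists_signed_permutation s t hst
  have : θ⁻¹ = π := mulAut_ext (hs.trans hx.symm) (ht.trans hy.symm)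
  apply h.not_preservesKappa
  rw [← inv_inv θ, this]
  exact hπ.inv

/-- Every automorphism of `F` preserves the conjugacy class of `kappa` up to inversion. -/
theorem preservesKappa (θ : MulAut F) : PreservesKappa θ := by
  induction hn : complexity θ using Nat.strong_induction_on generalizing θ with
  | _ n ih =>
    by_contra hθ
    exact not_isMinimalCounterexample θ ⟨hθ, fun φ hφ => ih _ (hn ▸ hφ) φ rfl⟩

/-! ### Reversal and palindromes -/

theorem Psi_mul (u v : F) : Psi (u * v) = Psi v * Psi u := by simp [Psi_eq]

theorem Psi_inv (u : F) : Psi u⁻¹ = (Psi u)⁻¹ := by simp [Psi_eq]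

theorem Psi_Psi (u : F) : Psi (Psi u) = u := by simp [Psi_eq]

theorem Psi_x : Psi x = x := by simp [Psi_eq]

theorem Psi_y : Psi y = y := by simp [Psi_eq]

/-- The hyperelliptic involution commutes with every automorphism up to an inner automorphism,
and the conjugating element is a palindrome. -/
theorem isPalindrome_of_mul_iota_mul_inv {θ : MulAut F} {c : F}
    (h : θ * iota * θ⁻¹ = MulAut.conj c * iota) : IsPalindrome c := by
  have h1 : (MulAut.conj c * iota) * (MulAut.conj c * iota) = 1 := by
    rw [← h, show θ * iota * θ⁻¹ * (θ * iota * θ⁻¹) = θ * (iota * iota) * θ⁻¹ by group,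
      iota_mul_iota]
    group
  -- The square of conj(c)ι is conj(c·ι(c)), so this element is central.
  have h2 (u : F) : Commute (c * iota c) u := by
    have h3 := DFunLike.congr_fun h1 u
    simp only [MulAut.mul_apply, MulAut.conj_apply, _root_.map_mul, _root_.map_inv, iota_iota,
      MulAut.one_apply] at h3
    rw [commute_iff_eq, ← mul_inv_eq_iff_eq_mul]
    refine Eq.trans ?_ h3
    group
  have h4 := eq_one_of_commute _ (h2 x) (h2 y)
  rw [IsPalindrome, Psi_eq]
  exact (eq_inv_of_mul_eq_one_left h4).symm

/-- Each image of a generator is conjugate to its reversal. -/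
theorem Psi_apply {θ : MulAut F} {c : F} (h : θ * iota * θ⁻¹ = MulAut.conj c * iota) {u : F}
    (hu : iota u = u⁻¹) : Psi (θ u) = c⁻¹ * θ u * c := by
  have h1 := DFunLike.congr_fun h (θ u)
  simp only [MulAut.mul_apply, MulAut.conj_apply, MulAut.inv_apply_self, hu, _root_.map_inv] at h1
  rw [Psi_eq, eq_comm, ← inv_inj, inv_inv]
  rw [mul_inv_rev, mul_inv_rev, h1]
  group

end RankTwo

theorem mainTheorem5 (p : RankTwo.F) (hp : RankTwo.IsPrimitive p) :
    ∃ v z : RankTwo.F, RankTwo.IsPalindrome v ∧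
      (p = z * RankTwo.y⁻¹ * v * RankTwo.x * z⁻¹ ∨
        p = z * RankTwo.x⁻¹ * v * RankTwo.y * z⁻¹) := by
  open RankTwo in
  obtain ⟨θ, rfl⟩ := hp
  obtain ⟨w, hw⟩ := preservesKappa θ
  have h1 : θ * kappa * θ⁻¹ = MulAut.conj (θ (x * y⁻¹)) * (θ * iota * θ⁻¹) := by
    rw [← mul_conj_mul_inv, kappa]
    group
  have key (u : F) (hu : θ * kappa * θ⁻¹ = MulAut.conj w * (MulAut.conj u * iota) *
      (MulAut.conj w)⁻¹) : ∃ c v, IsPalindrome c ∧ IsPalindrome v ∧ θ x = w * u * v * w⁻¹ ∧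
        Psi (θ x) = c⁻¹ * θ x * c := by
    rw [h1, conj_mul_conj_mul_iota_mul_inv, ← eq_inv_mul_iff_mul_eq, ← map_inv, ← mul_assoc,
      ← map_mul] at hu
    have hc := isPalindrome_of_mul_iota_mul_inv hu
    have hx := Psi_apply hu (u := x) (by simp)
    have hy := Psi_apply hu (u := y) (by simp)
    generalize hd : (θ (x * y⁻¹))⁻¹ * (w * u * Psi w) = c at *
    -- The definition of c gives θ(x) = w·u·Ψ(w)·c⁻¹·θ(y); the rest of v is forced.
    refine ⟨c, Psi w * c⁻¹ * θ y * w, hc, ?_, ?_, hx⟩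
    · rw [IsPalindrome] at hc ⊢
      rw [Psi_mul, Psi_mul, Psi_mul, Psi_inv, Psi_Psi, hc, hy]
      group
    · rw [← hd]
      simp only [map_mul, map_inv]
      group
  rcases hw with hw | hw
  · obtain ⟨c, v, -, hv, h, -⟩ := key (x * y⁻¹) (by rw [hw]; rfl)
    exact ⟨v, w * x, hv, Or.inl (by rw [h]; group)⟩
  · obtain ⟨c, v, hc, hv, h, h'⟩ := key (y⁻¹ * x) (by rw [hw, kappa_inv])
    -- Here θ(x) is conjugate to y⁻¹xv, whose reversal vxy⁻¹ is conjugate to y⁻¹vx; c conjugates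
    -- Ψ(θ(x)) back to θ(x).
    refine ⟨v, c * (Psi w)⁻¹ * y, hv, Or.inl ?_⟩
    rw [IsPalindrome] at hv
    have h2 : θ x = c * Psi (θ x) * c⁻¹ := by rw [h']; group
    rw [h2, h, Psi_mul, Psi_mul, Psi_mul, Psi_mul, Psi_inv, Psi_inv, hv, Psi_x, Psi_y]
    group
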